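/- For finite measures $\mu,\nu$ on $\mathbb R^n$ put $\|\mu-\nu\|_{\mathrm E}=\sup_B|\mu(B)-\nu(B)|$, the supremum over all boxes $B=\prod_{i=1}^n[a_i,b_i]$ with $0\le a_i<b_i<1$, and for points $z^{1:N}=(z^1,\dots,z^N)$ let $\mathcal S(z^{1:N})=\frac1N\sum_{n=1}^N\delta_{z^n}$. Let $d\ge 1$ and let $H:[0,1]\to[0,1]^d$ be a Hilbert curve with $H(0)=0$. That is, for every $m\ge0$ the $2^{md}$ closed dyadic cubes of side $2^{-m}$ of $[0,1]^d$ are enumerated without repetition as $S_m(0),\dots,S_m(2^{md}-1)$, such that $S_{m+1}(2^dk+i)\subseteq S_m(k)$ for $0\le i<2^d$, and such that $S_m(k)$ and $S_m(k+1)$ have at least an edge in common (an endpoint if $d=1$). $H$ is the limit of maps $H_m$ with $H_m(t)\in S_m(k)$ for $t$ in $I_m(k)=[k2^{-md},(k+1)2^{-md})$ (this interval being closed at $1$ for the last $k$), so that $H(t)\in S_m(k)$ for all $t\in I_m(k)$. Let $h:[0,1]^d\to[0,1]$ be a measurable pseudo-inverse of $H$, i.e. $H(h(x))=x$ for all $x\in[0,1]^d$.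 Let $\pi$ be a probability measure on $[0,1)^d$ with a bounded density with respect to Lebesgue measure, and let $\pi_h$ be its image by $h$. Let $K$ be a Markov kernel from $[0,1)^d$ to $[0,1)^s$, and let $K_h(h_1,\mathrm dx_2)=K(H(h_1),\mathrm dx_2)$ (this is defined for $\pi_h$-almost every $h_1$). Write $\pi\otimes K(\mathrm d(x_1,x_2))=\pi(\mathrm dx_1)K(x_1,\mathrm dx_2)$, and similarly $\pi_h\otimes K_h$. For each $N\ge1$ let $P_h^N=\big((h_1^n,x_2^n)\big)_{1\le n\le N}$ be $N$ points of $[0,1)^{1+s}$ (which may all change with $N$), and let $P^N=\big((H(h_1^n),x_2^n)\big)_{1\le n\le N}$. If $\|\mathcal S(P_h^N)-\pi_h\otimes K_h\|_{\mathrm E}\to0$ as $N\to\infty$, then $$\|\mathcal S(P^N)-\pi\otimes K\|_{\mathrm E}\to0\qquad\text{as }N\to\infty .$$ -/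

import Mathlib

open MeasureTheory ProbabilityTheory Filter Topology
open scoped NNReal ENNReal

/-- The half-open unit cube `[0,1)^n`. -/
def unitCube (n : ℕ) : Set (Fin n → ℝ) := {x | ∀ i, 0 ≤ x i ∧ x i < 1}

/-- The boxes `∏ [a i, b i]` with `0 ≤ a i < b i < 1`. -/
def boxes (n : ℕ) : Set (Set (Fin n → ℝ)) :=
  {B | ∃ a b : Fin n → ℝ, (∀ i, 0 ≤ a i ∧ a i < b i ∧ b i < 1) ∧ B = Set.Icc a b}

/-- The extreme norm `‖μ - ν‖_E = sup_B |μ(B) - ν(B)|` over the boxes `B`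
(a supremum of a bounded non-empty set of reals for finite measures). -/
noncomputable def extremeNorm {n : ℕ} (μ ν : Measure (Fin n → ℝ)) : ℝ :=
  ⨆ B : boxes n, |μ.real (B : Set (Fin n → ℝ)) - ν.real (B : Set (Fin n → ℝ))|

/-- The empirical measure `S(x^{1:N}) = (1/N) ∑ δ_{x^n}` of a point set. -/
noncomputable def empirical {n N : ℕ} (x : Fin N → (Fin n → ℝ)) : Measure (Fin n → ℝ) :=
  (N : ℝ≥0∞)⁻¹ • ∑ k, Measure.dirac (x k)

theorem measurable_append (m n : ℕ) :
    Measurable fun p : (Fin m → ℝ) × (Fin n → ℝ) => Fin.append p.1 p.2 := by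
  refine measurable_pi_lambda _ fun i => ?_
  refine Fin.addCases (fun j => ?_) (fun j => ?_) i
  · simp only [Fin.append_left]
    exact (measurable_pi_apply j).comp measurable_fst
  · simp only [Fin.append_right]
    exact (measurable_pi_apply j).comp measurable_snd

/-- The measure `π ⊗ K (d(x₁, x₂)) = π(dx₁) K(x₁, dx₂)`, on `ℝ^(m+n)`. -/
noncomputable def tensorKernel {m n : ℕ} (π : Measure (Fin m → ℝ))
    (K : Kernel (Fin m → ℝ) (Fin n → ℝ)) : Measure (Fin (m + n) → ℝ) :=
  (π ⊗ₘ K).map (fun p => Fin.append p.1 p.2)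

/-- The combinatorial data of a Hilbert curve in dimension `d`: for each level `m`, an enumeration
of the `2^(m*d)` dyadic cubes of side `2^(-m)` of `[0,1]^d`. The `j`-th cube is
`S_m(j) = ∏ i, [cell m j i / 2^m, (cell m j i + 1) / 2^m]`; it is attached to the interval
`I_m(j) = [j / 2^(m*d), (j + 1) / 2^(m*d)]`. -/
structure HilbertOrder (d : ℕ) where
  /-- `cell m j` is the integer vector of the lower corner of `S_m(j)`, in units of `2^(-m)`. -/
  cell : ℕ → ℕ → Fin d → ℕ
  /-- Every dyadic cube of level `m` is enumerated exactly once. -/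
  bijOn : ∀ m, Set.BijOn (cell m) (Set.Iio (2 ^ (m * d))) {c | ∀ i, c i < 2 ^ m}
  /-- Nesting: if `I_{m+1}(j) ⊆ I_m(k)`, that is `k = j / 2^d`, then `S_{m+1}(j) ⊆ S_m(k)`. -/
  nested : ∀ m j, j < 2 ^ ((m + 1) * d) → ∀ i, cell (m + 1) j i / 2 = cell m (j / 2 ^ d) i
  /-- Adjacency, first half: two successive cubes touch. -/
  touching : ∀ m j, j + 1 < 2 ^ (m * d) →
    ∀ i, cell m (j + 1) i ≤ cell m j i + 1 ∧ cell m j i ≤ cell m (j + 1) i + 1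
  /-- Adjacency, second half: their intersection contains an edge (when `d = 1` they are only
  required to share an endpoint). -/
  common_edge : 2 ≤ d → ∀ m j, j + 1 < 2 ^ (m * d) → ∃ i, cell m (j + 1) i = cell m j i

namespace HilbertOrder

variable {d : ℕ}

/-- The index `j < 2^(m*d)` of the interval `I_m(j)` that contains `t ∈ [0,1]`
(the right-hand one at an interior endpoint). -/
noncomputable def index (d m : ℕ) (t : ℝ) : ℕ := min ⌊t * 2 ^ (m * d)⌋₊ (2 ^ (m * d) - 1)

/-- The approximation `H_m` of the Hilbert curve: it sends `t ∈ I_m(j)` to the lower corner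
of `S_m(j)`. -/
noncomputable def approx (σ : HilbertOrder d) (m : ℕ) (t : ℝ) : Fin d → ℝ :=
  fun i => (σ.cell m (index d m t) i : ℝ) / 2 ^ m

/-- The Hilbert curve `H : [0,1] → [0,1]^d`, the limit of the `H_m` as `m → ∞`. By nesting `H_m` is
nondecreasing in `m` in each coordinate, so the limit is a supremum, see `tendsto_approx`. -/
noncomputable def curve (σ : HilbertOrder d) (t : ℝ) : Fin d → ℝ :=
  fun i => ⨆ m, σ.approx m t i

theorem index_lt (d m : ℕ) (t : ℝ) : index d m t < 2 ^ (m * d) := by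
  have : 0 < 2 ^ (m * d) := by positivity
  unfold index
  omega

theorem index_succ (d m : ℕ) (t : ℝ) : index d (m + 1) t / 2 ^ d = index d m t := by
  have e : (2 : ℕ) ^ ((m + 1) * d) = 2 ^ (m * d) * 2 ^ d := by rw [← pow_add]; ring_nf
  have e' : (2 : ℝ) ^ ((m + 1) * d) = 2 ^ (m * d) * 2 ^ d := by rw [← pow_add]; ring_nf
  have hf : ⌊t * 2 ^ ((m + 1) * d)⌋₊ / 2 ^ d = ⌊t * 2 ^ (m * d)⌋₊ := by
    rw [← Nat.floor_div_natCast, e']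
    congr 1
    push_cast
    field_simp
  have hl : (2 ^ ((m + 1) * d) - 1) / 2 ^ d = 2 ^ (m * d) - 1 := by
    rw [e]
    obtain ⟨a, ha⟩ : ∃ a, 2 ^ (m * d) = a + 1 := Nat.exists_eq_succ_of_ne_zero (by positivity)
    obtain ⟨b, hb⟩ : ∃ b, 2 ^ d = b + 1 := Nat.exists_eq_succ_of_ne_zero (by positivity)
    rw [ha, hb]
    have : (a + 1) * (b + 1) - 1 = b + (b + 1) * a := by
      have : (a + 1) * (b + 1) = b + (b + 1) * a + 1 := by ring
      omega
    rw [this, Nat.add_mul_div_left _ _ (Nat.succ_pos b), Nat.div_eq_of_lt (Nat.lt_succ_self b)]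
    omega
  unfold index
  rw [← hf, ← hl]
  have hmono : Monotone fun j : ℕ => j / 2 ^ d := fun a b hab => Nat.div_le_div_right hab
  exact hmono.map_min

theorem approx_le_one (σ : HilbertOrder d) (m : ℕ) (t : ℝ) (i : Fin d) : σ.approx m t i ≤ 1 := by
  have h := (σ.bijOn m).mapsTo (index_lt d m t) i
  unfold approx
  rw [div_le_one (by positivity)]
  exact_mod_cast h.le

theorem monotone_approx (σ : HilbertOrder d) (t : ℝ) (i : Fin d) :
    Monotone fun m => σ.approx m t i := by
  refine monotone_nat_of_le_succ fun m => ?_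
  have h := σ.nested m _ (index_lt d (m + 1) t) i
  rw [index_succ] at h
  have h2 : 2 * σ.cell m (index d m t) i ≤ σ.cell (m + 1) (index d (m + 1) t) i := by omega
  have h3 : (2 : ℝ) * σ.cell m (index d m t) i ≤ σ.cell (m + 1) (index d (m + 1) t) i := by
    exact_mod_cast h2
  unfold approx
  rw [div_le_div_iff₀ (by positivity) (by positivity), pow_succ]
  nlinarith [pow_pos (two_pos : (0 : ℝ) < 2) m]

/-- `H` is the pointwise limit of the `H_m`. -/
theorem tendsto_approx (σ : HilbertOrder d) (t : ℝ) :
    Tendsto (fun m => σ.approx m t) atTop (𝓝 (σ.curve t)) := by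
  refine tendsto_pi_nhds.2 fun i => tendsto_atTop_ciSup (σ.monotone_approx t i) ?_
  exact ⟨1, by rintro _ ⟨m, rfl⟩; exact σ.approx_le_one m t i⟩

theorem measurable_curve (σ : HilbertOrder d) : Measurable σ.curve := by
  refine measurable_pi_lambda _ fun i => Measurable.iSup fun m => ?_
  have h : Measurable (index d m) :=
    (Nat.measurable_floor.comp (measurable_id.mul_const _)).min measurable_const
  exact (measurable_from_top (f := fun j : ℕ => (σ.cell m j i : ℝ) / 2 ^ m)).comp h

/-- `h : [0,1]^d → [0,1]` is a pseudo-inverse of the Hilbert curve: `H (h x) = x`. -/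
def IsPseudoInverse (σ : HilbertOrder d) (h : (Fin d → ℝ) → ℝ) : Prop :=
  ∀ x : Fin d → ℝ, (∀ i, 0 ≤ x i ∧ x i ≤ 1) → (0 ≤ h x ∧ h x ≤ 1) ∧ σ.curve (h x) = x

/-- The kernel `K_h(h₁, dx₂) = K(H(h₁), dx₂)`. -/
noncomputable def pullKernel (σ : HilbertOrder d) {s : ℕ} (K : Kernel (Fin d → ℝ) (Fin s → ℝ)) :
    Kernel (Fin 1 → ℝ) (Fin s → ℝ) :=
  K.comap (fun t => σ.curve (t 0)) (σ.measurable_curve.comp (measurable_pi_apply 0))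

instance (σ : HilbertOrder d) {s : ℕ} (K : Kernel (Fin d → ℝ) (Fin s → ℝ)) [IsMarkovKernel K] :
    IsMarkovKernel (σ.pullKernel K) := by
  unfold pullKernel
  infer_instance

end HilbertOrder

/-- The image `π_h` of `π` by `h`, as a measure on `ℝ^1`. -/
noncomputable def imageLine {d : ℕ} (π : Measure (Fin d → ℝ)) (h : (Fin d → ℝ) → ℝ) :
    Measure (Fin 1 → ℝ) :=
  π.map (fun x _ => h x)

/-! ### Discrepancy over boxes and half-open strips. -/

section BoxDiscrepancy

/-! Both measures in the conclusion are images under `(t, y) ↦ (H t, y)`: for the points this is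
immediate, and for `π ⊗ K` it holds because `H ∘ h = id` almost everywhere
(`map_lift_tensorKernel`). The preimage of a box lies between two unions of at most `2^(m*d)`
disjoint strips `I_m(j) × [c, e]`, indexed by the cubes inside the box and by those touching it.
Each strip costs at most one extreme norm (`abs_measureReal_strip_sub_le`). Where the unions differ,
`H t` is within `2^(-m)` of a face, which has limit mass `O(2^(-m))` by the bounded density
(`measure_nearFaces_le`). Hence the new norm is at most `2^(m*d)` times the old one plus `O(2^(-m))`
(`extremeNorm_map_lift_le`). Letting `N → ∞` at fixed `m`, with `m` chosen large beforehand,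
suffices. -/

theorem bddAbove_abs_measureReal_sub {n : ℕ} (μ ν : Measure (Fin n → ℝ)) [IsFiniteMeasure μ]
    [IsFiniteMeasure ν] :
    BddAbove (Set.range fun B : boxes n =>
      |μ.real (B : Set (Fin n → ℝ)) - ν.real (B : Set (Fin n → ℝ))|) := by
  refine ⟨μ.real Set.univ + ν.real Set.univ, ?_⟩
  rintro _ ⟨B, rfl⟩
  have h1 : μ.real (B : Set (Fin n → ℝ)) ≤ μ.real Set.univ := measureReal_mono (Set.subset_univ _)
  have h2 : ν.real (B : Set (Fin n → ℝ)) ≤ ν.real Set.univ := measureReal_mono (Set.subset_univ _)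
  have h3 : 0 ≤ μ.real (B : Set (Fin n → ℝ)) := measureReal_nonneg
  have h4 : 0 ≤ ν.real (B : Set (Fin n → ℝ)) := measureReal_nonneg
  exact abs_le.2 ⟨by linarith, by linarith⟩

theorem abs_measureReal_sub_le_extremeNorm {n : ℕ} (μ ν : Measure (Fin n → ℝ)) [IsFiniteMeasure μ]
    [IsFiniteMeasure ν] {B : Set (Fin n → ℝ)} (hB : B ∈ boxes n) :
    |μ.real B - ν.real B| ≤ extremeNorm μ ν :=
  le_ciSup (bddAbove_abs_measureReal_sub μ ν) ⟨B, hB⟩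

theorem extremeNorm_nonneg {n : ℕ} (μ ν : Measure (Fin n → ℝ)) : 0 ≤ extremeNorm μ ν :=
  Real.iSup_nonneg fun _ => abs_nonneg _

/-- The sets `[l, u) × [c, e]` of `ℝ^(1+s)`. -/
def strip {s : ℕ} (l u : ℝ) (c e : Fin s → ℝ) : Set (Fin (1 + s) → ℝ) :=
  {z | z (Fin.castAdd s 0) ∈ Set.Ico l u ∧ (fun i => z (Fin.natAdd 1 i)) ∈ Set.Icc c e}

theorem measurableSet_strip {s : ℕ} (l u : ℝ) (c e : Fin s → ℝ) :
    MeasurableSet (strip l u c e) :=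
  ((measurable_pi_apply _) measurableSet_Ico).inter
    ((measurable_pi_lambda _ fun _ => measurable_pi_apply _) measurableSet_Icc)

theorem mem_Icc_append_iff {m n : ℕ} {a b : Fin m → ℝ} {c e : Fin n → ℝ} {z : Fin (m + n) → ℝ} :
    z ∈ Set.Icc (Fin.append a c) (Fin.append b e) ↔
      (fun i => z (Fin.castAdd n i)) ∈ Set.Icc a b ∧
        (fun i => z (Fin.natAdd m i)) ∈ Set.Icc c e := by
  simp only [Set.mem_Icc, Pi.le_def, Fin.forall_fin_add, Fin.append_left, Fin.append_right]
  tauto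

/-- The half-open interval is an increasing union of closed ones, so the extreme norm also
controls strips. -/
theorem abs_measureReal_strip_sub_le {s : ℕ} (μ ν : Measure (Fin (1 + s) → ℝ)) [IsFiniteMeasure μ]
    [IsFiniteMeasure ν] {l u : ℝ} {c e : Fin s → ℝ} (hl : 0 ≤ l) (hlu : l < u) (hu : u ≤ 1)
    (hce : ∀ i, 0 ≤ c i ∧ c i < e i ∧ e i < 1) :
    |μ.real (strip l u c e) - ν.real (strip l u c e)| ≤ extremeNorm μ ν := by
  obtain ⟨v, hv_mono, hv_mem, hv_lim⟩ := exists_seq_strictMono_tendsto' hlu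
  let B : ℕ → Set (Fin (1 + s) → ℝ) := fun k =>
    Set.Icc (Fin.append (fun _ => l) c) (Fin.append (fun _ => v k) e)
  have hB : ∀ k, B k ∈ boxes (1 + s) := fun k => by
    refine ⟨_, _, ?_, rfl⟩
    rw [Fin.forall_fin_add]
    refine ⟨fun i => ?_, fun i => ?_⟩
    · simp only [Fin.append_left]
      exact ⟨hl, (hv_mem k).1, (hv_mem k).2.trans_le hu⟩
    · simp only [Fin.append_right]
      exact hce i
  have hB_mono : Monotone B := fun i j hij => by
    refine Set.Icc_subset_Icc_right ?_
    rw [Pi.le_def, Fin.forall_fin_add]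
    exact ⟨fun _ => by simpa using hv_mono.monotone hij, fun _ => by simp⟩
  have hB_union : ⋃ k, B k = strip l u c e := by
    ext z
    simp only [Set.mem_iUnion, B, mem_Icc_append_iff, strip, Set.mem_ofPred_eq]
    constructor
    · rintro ⟨k, h1, h2⟩
      exact ⟨⟨h1.1 0, (h1.2 0).trans_lt (hv_mem k).2⟩, h2⟩
    · rintro ⟨h1, h2⟩
      obtain ⟨k, hk⟩ := (hv_lim.eventually (lt_mem_nhds h1.2)).exists
      refine ⟨k, ⟨fun i => ?_, fun i => ?_⟩, h2⟩
      · rw [Subsingleton.elim i 0]; exact h1.1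
      · rw [Subsingleton.elim i 0]; exact hk.le
  have lim : ∀ ρ : Measure (Fin (1 + s) → ℝ), IsFiniteMeasure ρ →
      Tendsto (fun k => ρ.real (B k)) atTop (𝓝 (ρ.real (strip l u c e))) := fun ρ _ => by
    rw [← hB_union]
    exact (ENNReal.tendsto_toReal (measure_ne_top _ _)).comp
      (tendsto_measure_iUnion_atTop hB_mono)
  exact le_of_tendsto ((lim μ ‹_›).sub (lim ν ‹_›)).abs
    (Eventually.of_forall fun k => abs_measureReal_sub_le_extremeNorm μ ν (hB k))

end BoxDiscrepancy

/-! ### Localising the curve in dyadic cubes. -/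

namespace HilbertOrder

variable {d : ℕ}

theorem approx_le_curve (σ : HilbertOrder d) (m : ℕ) (t : ℝ) (i : Fin d) :
    σ.approx m t i ≤ σ.curve t i :=
  le_ciSup (f := fun m => σ.approx m t i)
    ⟨1, by rintro _ ⟨m, rfl⟩; exact σ.approx_le_one m t i⟩ m

/-- These are the upper corners of nested cubes. Together with the increasing lower corners they
trap `H t` in the closed cube of every level. -/
theorem antitone_approx_add (σ : HilbertOrder d) (t : ℝ) (i : Fin d) :
    Antitone fun m => σ.approx m t i + 1 / 2 ^ m := by
  refine antitone_nat_of_succ_le fun m => ?_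
  have h := σ.nested m _ (index_lt d (m + 1) t) i
  rw [index_succ] at h
  have h2 : σ.cell (m + 1) (index d (m + 1) t) i ≤ 2 * σ.cell m (index d m t) i + 1 := by omega
  have h3 : (σ.cell (m + 1) (index d (m + 1) t) i : ℝ) ≤ 2 * σ.cell m (index d m t) i + 1 := by
    exact_mod_cast h2
  unfold approx
  rw [← add_div, ← add_div, div_le_div_iff₀ (by positivity) (by positivity), pow_succ]
  nlinarith [pow_pos (two_pos : (0 : ℝ) < 2) m]

theorem curve_le_approx_add (σ : HilbertOrder d) (m : ℕ) (t : ℝ) (i : Fin d) :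
    σ.curve t i ≤ σ.approx m t i + 1 / 2 ^ m := by
  refine ciSup_le fun k => ?_
  have h1 : σ.approx k t i ≤ σ.approx (max k m) t i := σ.monotone_approx t i (le_max_left k m)
  have h2 : σ.approx (max k m) t i + 1 / 2 ^ (max k m) ≤ σ.approx m t i + 1 / 2 ^ m :=
    σ.antitone_approx_add t i (le_max_right k m)
  have h3 : (0 : ℝ) < 1 / 2 ^ (max k m) := by positivity
  linarith

theorem index_eq {m j : ℕ} {t : ℝ} (hj : j < 2 ^ (m * d))
    (ht : t ∈ Set.Ico ((j : ℝ) / 2 ^ (m * d)) ((j + 1) / 2 ^ (m * d))) : index d m t = j := by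
  have hq : (0 : ℝ) < 2 ^ (m * d) := by positivity
  have h1 := (div_le_iff₀ hq).1 ht.1
  have h2 := (lt_div_iff₀ hq).1 ht.2
  have : ⌊t * 2 ^ (m * d)⌋₊ = j :=
    (Nat.floor_eq_iff ((Nat.cast_nonneg j).trans h1)).2 ⟨h1, h2⟩
  unfold index
  omega

theorem mem_Ico_index (d m : ℕ) {t : ℝ} (ht : t ∈ Set.Ico (0 : ℝ) 1) :
    t ∈ Set.Ico ((index d m t : ℝ) / 2 ^ (m * d)) ((index d m t + 1) / 2 ^ (m * d)) := by
  have hq : (0 : ℝ) < 2 ^ (m * d) := by positivity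
  have h0 : 0 ≤ t * 2 ^ (m * d) := mul_nonneg ht.1 hq.le
  -- This is where `t < 1` matters: the truncation in `index` is then inactive.
  have h1 : ⌊t * 2 ^ (m * d)⌋₊ < 2 ^ (m * d) := by
    rw [Nat.floor_lt h0]
    push_cast
    nlinarith [ht.2]
  have h2 : index d m t = ⌊t * 2 ^ (m * d)⌋₊ := by
    unfold index
    omega
  rw [h2, Set.mem_Ico, div_le_iff₀ hq, lt_div_iff₀ hq]
  exact ⟨Nat.floor_le h0, Nat.lt_floor_add_one _⟩

/-- The map `(t, y) ↦ (H t, y)` on `ℝ^(1+s)`. -/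
noncomputable def lift (σ : HilbertOrder d) (s : ℕ) (z : Fin (1 + s) → ℝ) : Fin (d + s) → ℝ :=
  Fin.append (σ.curve (z (Fin.castAdd s 0))) fun i => z (Fin.natAdd 1 i)

theorem measurable_lift (σ : HilbertOrder d) (s : ℕ) : Measurable (σ.lift s) :=
  (measurable_append d s).comp
    ((σ.measurable_curve.comp (measurable_pi_apply _)).prodMk
      (measurable_pi_lambda _ fun _ => measurable_pi_apply _))

theorem lift_append (σ : HilbertOrder d) {s : ℕ} (t : Fin 1 → ℝ) (y : Fin s → ℝ) :
    σ.lift s (Fin.append t y) = Fin.append (σ.curve (t 0)) y := by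
  simp [lift]

end HilbertOrder

/-! ### Mass near the faces of a box. -/

/-- The points that have a coordinate within `δ` of the corresponding one of `a` or of `b`. -/
def nearFaces {d : ℕ} (δ : ℝ) (a b : Fin d → ℝ) : Set (Fin d → ℝ) :=
  ⋃ i, ({x | x i ∈ Set.Icc (a i - δ) (a i + δ)} ∪ {x | x i ∈ Set.Icc (b i - δ) (b i + δ)})

theorem measurableSet_nearFaces {d : ℕ} (δ : ℝ) (a b : Fin d → ℝ) :
    MeasurableSet (nearFaces δ a b) :=
  MeasurableSet.iUnion fun i =>
    ((measurable_pi_apply i) measurableSet_Icc).union ((measurable_pi_apply i) measurableSet_Icc)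

theorem measurableSet_unitCube (n : ℕ) : MeasurableSet (unitCube n) := by
  have : unitCube n = Set.pi Set.univ fun _ => Set.Ico (0 : ℝ) 1 := by
    ext x; simp [unitCube, Set.mem_pi]
  rw [this]
  exact MeasurableSet.univ_pi fun _ => measurableSet_Ico

theorem volume_slab_inter_unitCube_le {d : ℕ} (i : Fin d) (l u : ℝ) :
    volume ({x : Fin d → ℝ | x i ∈ Set.Icc l u} ∩ unitCube d) ≤ ENNReal.ofReal (u - l) := by
  have hsub : {x : Fin d → ℝ | x i ∈ Set.Icc l u} ∩ unitCube d ⊆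
      Set.pi Set.univ (Function.update (fun _ => Set.Ico (0 : ℝ) 1) i (Set.Icc l u)) := by
    rintro x ⟨hx, hx'⟩ j -
    rcases eq_or_ne j i with rfl | hji
    · simpa using hx
    · simpa [Function.update_of_ne hji] using hx' j
  refine (measure_mono hsub).trans ?_
  rw [volume_pi_pi, ← Finset.mul_prod_erase _ _ (Finset.mem_univ i)]
  rw [Finset.prod_eq_one]
  · simp
  · intro j hj
    rw [Function.update_of_ne (Finset.ne_of_mem_erase hj)]
    simp

/-- Union bound over `d` coordinates, with two slabs of width `2 * δ` each, the density being at
most `M`. -/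
theorem measure_nearFaces_le {d : ℕ} {π : Measure (Fin d → ℝ)} {f : (Fin d → ℝ) → ℝ≥0} {M : ℝ≥0}
    (hfM : ∀ x ∈ unitCube d, f x ≤ M)
    (hπ : π = (volume.restrict (unitCube d)).withDensity (fun x => (f x : ℝ≥0∞)))
    (δ : ℝ) (a b : Fin d → ℝ) :
    π (nearFaces δ a b) ≤ M * (d * (2 * ENNReal.ofReal (2 * δ))) := by
  have hle : π ≤ (M : ℝ≥0∞) • volume.restrict (unitCube d) := by
    rw [hπ, ← withDensity_const]
    refine withDensity_mono ?_
    filter_upwards [ae_restrict_mem (measurableSet_unitCube d)] with x hx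
    exact_mod_cast hfM x hx
  refine (hle _).trans ?_
  rw [Measure.smul_apply, smul_eq_mul]
  gcongr
  refine (measure_iUnion_le _).trans ?_
  rw [tsum_fintype]
  refine (Finset.sum_le_card_nsmul _ _ (2 * ENNReal.ofReal (2 * δ)) fun i _ => ?_).trans (by simp)
  refine (measure_union_le _ _).trans ?_
  rw [Measure.restrict_apply' (measurableSet_unitCube d),
    Measure.restrict_apply' (measurableSet_unitCube d), two_mul]
  refine add_le_add ?_ ?_ <;> refine (volume_slab_inter_unitCube_le i _ _).trans_eq ?_ <;>
    congr 1 <;> ring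

/-! ### Transfer of discrepancy and of measures along the curve. -/

namespace HilbertOrder

variable {d : ℕ}

/-- Transfer of discrepancy bounds from `ℝ^(1+s)` to `ℝ^(d+s)` along `(t, y) ↦ (H t, y)`: a box is
enclosed between two unions of cubes of level `m`, that differ by cubes near its faces. -/
theorem extremeNorm_map_lift_le (σ : HilbertOrder d) {s : ℕ} (μ ν : Measure (Fin (1 + s) → ℝ))
    [IsFiniteMeasure μ] [IsFiniteMeasure ν]
    (hμ : ∀ᵐ z ∂μ, z (Fin.castAdd s 0) ∈ Set.Ico (0 : ℝ) 1)
    (hν : ∀ᵐ z ∂ν, z (Fin.castAdd s 0) ∈ Set.Ico (0 : ℝ) 1)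
    (m : ℕ) {ε : ℝ} (hε : 0 ≤ ε) (hνε : ∀ a b : Fin d → ℝ,
      ν.real {z | σ.curve (z (Fin.castAdd s 0)) ∈ nearFaces (1 / 2 ^ m) a b} ≤ ε) :
    extremeNorm (μ.map (σ.lift s)) (ν.map (σ.lift s)) ≤
      2 ^ (m * d) * extremeNorm μ ν + ε := by
  classical
  refine Real.iSup_le ?_ (add_nonneg (mul_nonneg (by positivity) (extremeNorm_nonneg _ _)) hε)
  rintro ⟨_, a, b, hab, rfl⟩
  have hBm : MeasurableSet (Set.Icc a b) := measurableSet_Icc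
  rw [map_measureReal_apply (σ.measurable_lift s) hBm,
    map_measureReal_apply (σ.measurable_lift s) hBm]
  set D := extremeNorm μ ν with hD
  have hD0 : 0 ≤ D := extremeNorm_nonneg μ ν
  set B := σ.lift s ⁻¹' Set.Icc a b with hB
  let c : Fin s → ℝ := fun i => a (Fin.natAdd d i)
  let e : Fin s → ℝ := fun i => b (Fin.natAdd d i)
  let lo : ℕ → Fin d → ℝ := fun j i => (σ.cell m j i : ℝ) / 2 ^ m
  let E : ℕ → Set (Fin (1 + s) → ℝ) := fun j =>
    strip ((j : ℝ) / 2 ^ (m * d)) ((j + 1) / 2 ^ (m * d)) c e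
  let J := Finset.range (2 ^ (m * d))
  -- `Jin` selects the cubes contained in the first `d` sides of the box, `Jout` those that meet
  -- them.
  let Jin := J.filter fun j => ∀ i, a (Fin.castAdd s i) ≤ lo j i ∧
    lo j i + 1 / 2 ^ m ≤ b (Fin.castAdd s i)
  let Jout := J.filter fun j => ∀ i, a (Fin.castAdd s i) ≤ lo j i + 1 / 2 ^ m ∧
    lo j i ≤ b (Fin.castAdd s i)
  have hEidx : ∀ j ∈ J, ∀ z ∈ E j, index d m (z (Fin.castAdd s 0)) = j := fun j hj z hz =>
    index_eq (Finset.mem_range.1 hj) hz.1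
  have hEcube : ∀ j ∈ J, ∀ z ∈ E j, ∀ i, lo j i ≤ σ.curve (z (Fin.castAdd s 0)) i ∧
      σ.curve (z (Fin.castAdd s 0)) i ≤ lo j i + 1 / 2 ^ m := fun j hj z hz i => by
    have h1 := σ.approx_le_curve m (z (Fin.castAdd s 0)) i
    have h2 := σ.curve_le_approx_add m (z (Fin.castAdd s 0)) i
    unfold approx at h1 h2
    rw [hEidx j hj z hz] at h1 h2
    exact ⟨h1, h2⟩
  have hmemB : ∀ z, z ∈ B ↔ (∀ i, a (Fin.castAdd s i) ≤ σ.curve (z (Fin.castAdd s 0)) i ∧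
      σ.curve (z (Fin.castAdd s 0)) i ≤ b (Fin.castAdd s i)) ∧
      (fun i => z (Fin.natAdd 1 i)) ∈ Set.Icc c e := fun z => by
    simp only [hB, Set.mem_preimage, Set.mem_Icc, Pi.le_def, Fin.forall_fin_add, lift,
      Fin.append_left, Fin.append_right, c, e, forall_and]
    tauto
  have hin : (⋃ j ∈ Jin, E j) ⊆ B := by
    intro z hz
    obtain ⟨j, hj, hzj⟩ := Set.mem_iUnion₂.1 hz
    obtain ⟨hjJ, hj⟩ := Finset.mem_filter.1 hj
    refine (hmemB z).2 ⟨fun i => ?_, hzj.2⟩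
    have := hEcube j hjJ z hzj i
    exact ⟨(hj i).1.trans this.1, this.2.trans (hj i).2⟩
  have hout : ∀ z, z (Fin.castAdd s 0) ∈ Set.Ico (0 : ℝ) 1 → z ∈ B → z ∈ ⋃ j ∈ Jout, E j := by
    intro z hz hzB
    obtain ⟨h1, h2⟩ := (hmemB z).1 hzB
    have hjJ : index d m (z (Fin.castAdd s 0)) ∈ J := Finset.mem_range.2 (index_lt d m _)
    have hzE : z ∈ E (index d m (z (Fin.castAdd s 0))) := ⟨mem_Ico_index d m hz, h2⟩
    refine Set.mem_iUnion₂.2 ⟨_, Finset.mem_filter.2 ⟨hjJ, fun i => ?_⟩, hzE⟩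
    have := hEcube _ hjJ z hzE i
    exact ⟨(h1 i).1.trans this.2, this.1.trans (h1 i).2⟩
  -- A cube that meets the box without being inside it crosses a face in some coordinate `i`. Its
  -- side being `2^(-m)`, all its points are that close to the face.
  have hdiff : (⋃ j ∈ Jout, E j) ⊆ (⋃ j ∈ Jin, E j) ∪
      {z | σ.curve (z (Fin.castAdd s 0)) ∈ nearFaces (1 / 2 ^ m)
        (fun i => a (Fin.castAdd s i)) (fun i => b (Fin.castAdd s i))} := by
    intro z hz
    obtain ⟨j, hj, hzj⟩ := Set.mem_iUnion₂.1 hz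
    obtain ⟨hjJ, hj⟩ := Finset.mem_filter.1 hj
    by_cases hji : j ∈ Jin
    · exact Or.inl (Set.mem_iUnion₂.2 ⟨j, hji, hzj⟩)
    · right
      have : ∃ i, lo j i < a (Fin.castAdd s i) ∨ b (Fin.castAdd s i) < lo j i + 1 / 2 ^ m := by
        by_contra! hcon
        exact hji (Finset.mem_filter.2 ⟨hjJ, hcon⟩)
      obtain ⟨i, hi⟩ := this
      have h1 := hEcube j hjJ z hzj i
      have h2 := hj i
      refine Set.mem_iUnion.2 ⟨i, hi.imp (fun hi => ?_) fun hi => ?_⟩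
      · exact ⟨by linarith, by linarith⟩
      · exact ⟨by linarith, by linarith⟩
  have hsum : ∀ ρ : Measure (Fin (1 + s) → ℝ), IsFiniteMeasure ρ → ∀ T ⊆ J,
      ρ.real (⋃ j ∈ T, E j) = ∑ j ∈ T, ρ.real (E j) := fun ρ _ T hT => by
    refine measureReal_biUnion_finset (fun i hi j hj hij => ?_) fun j _ => measurableSet_strip _ _ _ _
    refine Set.disjoint_left.2 fun z hzi hzj => hij ?_
    rw [← hEidx i (hT hi) z hzi, hEidx j (hT hj) z hzj]
  have hE : ∀ j ∈ J, |μ.real (E j) - ν.real (E j)| ≤ D := fun j hj => by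
    have hj' : (j : ℝ) + 1 ≤ 2 ^ (m * d) := by exact_mod_cast Finset.mem_range.1 hj
    refine abs_measureReal_strip_sub_le μ ν (by positivity) ?_ ?_ fun i => hab _
    · gcongr; linarith
    -- Equality occurs for the last interval: strips may end at `1`, boxes may not.
    · rw [div_le_one (by positivity)]; exact hj'
  have hU : ∀ T ⊆ J, |μ.real (⋃ j ∈ T, E j) - ν.real (⋃ j ∈ T, E j)| ≤ 2 ^ (m * d) * D :=
    fun T hT => by
    rw [hsum μ ‹_› T hT, hsum ν ‹_› T hT, ← Finset.sum_sub_distrib]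
    refine (Finset.abs_sum_le_sum_abs _ _).trans ?_
    refine (Finset.sum_le_card_nsmul _ _ D fun j hj => hE j (hT hj)).trans ?_
    rw [nsmul_eq_mul]
    gcongr
    have := Finset.card_le_card hT
    rw [Finset.card_range] at this
    exact_mod_cast this
  have hle : ∀ ρ : Measure (Fin (1 + s) → ℝ), IsFiniteMeasure ρ →
      (∀ᵐ z ∂ρ, z (Fin.castAdd s 0) ∈ Set.Ico (0 : ℝ) 1) →
      ρ.real (⋃ j ∈ Jin, E j) ≤ ρ.real B ∧ ρ.real B ≤ ρ.real (⋃ j ∈ Jout, E j) :=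
    fun ρ _ hρ => ⟨measureReal_mono hin, ENNReal.toReal_mono (measure_ne_top _ _)
      (measure_mono_ae (hρ.mono fun z hz => hout z hz))⟩
  -- The gap is measured under `ν` only; `μ` is compared with `ν` on each union separately.
  have hgap : ν.real (⋃ j ∈ Jout, E j) ≤ ν.real (⋃ j ∈ Jin, E j) + ε :=
    (measureReal_mono hdiff).trans ((measureReal_union_le _ _).trans (by gcongr; exact hνε _ _))
  have h1 := abs_le.1 (hU Jin (Finset.filter_subset _ _))
  have h2 := abs_le.1 (hU Jout (Finset.filter_subset _ _))
  have h3 := hle μ ‹_› hμ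
  have h4 := hle ν ‹_› hν
  exact abs_le.2 ⟨by linarith, by linarith⟩

theorem map_lift_empirical (σ : HilbertOrder d) {s N : ℕ} (t : Fin N → Fin 1 → ℝ)
    (y : Fin N → Fin s → ℝ) :
    (empirical fun n => Fin.append (t n) (y n)).map (σ.lift s) =
      empirical fun n => Fin.append (σ.curve (t n 0)) (y n) := by
  ext A hA
  rw [Measure.map_apply (σ.measurable_lift s) hA]
  simp only [empirical, Measure.smul_apply, Measure.finsetSum_apply]
  congr 1
  refine Finset.sum_congr rfl fun n _ => ?_
  rw [Measure.dirac_apply' _ (σ.measurable_lift s hA), Measure.dirac_apply' _ hA,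
    ← lift_append]
  rfl

/-- At `h₁ = h x` the pulled-back kernel is `K (H (h x)) = K x`, so the two iterated integrals agree
for almost every `x`. -/
theorem map_lift_tensorKernel (σ : HilbertOrder d) {s : ℕ} {h : (Fin d → ℝ) → ℝ}
    (h_meas : Measurable h) (π : Measure (Fin d → ℝ)) [IsProbabilityMeasure π]
    (hπ : ∀ᵐ x ∂π, σ.curve (h x) = x)
    (K : Kernel (Fin d → ℝ) (Fin s → ℝ)) [IsMarkovKernel K] :
    (tensorKernel (imageLine π h) (σ.pullKernel K)).map (σ.lift s) = tensorKernel π K := by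
  have h1 : Measurable fun (x : Fin d → ℝ) (_ : Fin 1) => h x :=
    measurable_pi_lambda _ fun _ => h_meas
  have : IsProbabilityMeasure (imageLine π h) := Measure.isProbabilityMeasure_map h1.aemeasurable
  ext A hA
  unfold tensorKernel
  rw [Measure.map_map (σ.measurable_lift s) (measurable_append 1 s),
    Measure.map_apply ((σ.measurable_lift s).comp (measurable_append 1 s)) hA,
    Measure.map_apply (measurable_append d s) hA,
    Measure.compProd_apply (((σ.measurable_lift s).comp (measurable_append 1 s)) hA),
    Measure.compProd_apply (measurable_append d s hA), imageLine,
    lintegral_map (Kernel.measurable_kernel_prodMk_left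
      (((σ.measurable_lift s).comp (measurable_append 1 s)) hA)) h1]
  refine lintegral_congr_ae (hπ.mono fun x hx => ?_)
  simp only [pullKernel, Kernel.comap_apply, hx]
  congr 1
  ext y
  simp only [Set.mem_preimage, Function.comp_apply, lift_append, hx]

end HilbertOrder

/-! ### First marginals and empirical measures. -/

theorem tensorKernel_fst_preimage {m n : ℕ} (π : Measure (Fin m → ℝ)) [IsProbabilityMeasure π]
    (K : Kernel (Fin m → ℝ) (Fin n → ℝ)) [IsMarkovKernel K] {A : Set (Fin m → ℝ)}
    (hA : MeasurableSet A) :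
    tensorKernel π K {z | (fun i => z (Fin.castAdd n i)) ∈ A} = π A := by
  have hm : MeasurableSet {z : Fin (m + n) → ℝ | (fun i => z (Fin.castAdd n i)) ∈ A} :=
    (measurable_pi_lambda _ fun _ => measurable_pi_apply _) hA
  have hpre : (fun p : (Fin m → ℝ) × (Fin n → ℝ) => Fin.append p.1 p.2) ⁻¹'
      {z | (fun i => z (Fin.castAdd n i)) ∈ A} = A ×ˢ Set.univ := by
    ext p; simp
  rw [tensorKernel, Measure.map_apply (measurable_append m n) hm, hpre,
    Measure.compProd_apply_prod hA MeasurableSet.univ]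
  simp

instance {m n : ℕ} (π : Measure (Fin m → ℝ)) [IsProbabilityMeasure π]
    (K : Kernel (Fin m → ℝ) (Fin n → ℝ)) [IsMarkovKernel K] :
    IsProbabilityMeasure (tensorKernel π K) :=
  Measure.isProbabilityMeasure_map (measurable_append m n).aemeasurable

instance {n N : ℕ} (x : Fin N → (Fin n → ℝ)) : IsFiniteMeasure (empirical x) := by
  -- For `N = 0` the weight is `∞`, but it multiplies the zero measure.
  rcases Nat.eq_zero_or_pos N with rfl | hN
  · unfold empirical
    simp only [Finset.univ_eq_empty, Finset.sum_empty, smul_zero]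
    infer_instance
  · refine ⟨?_⟩
    simp only [empirical, Measure.smul_apply, Measure.finsetSum_apply, measure_univ, smul_eq_mul]
    refine ENNReal.mul_lt_top ?_ (by simp)
    simpa using hN

theorem ae_empirical_of_forall {n N : ℕ} {x : Fin N → (Fin n → ℝ)} {p : (Fin n → ℝ) → Prop}
    (hp : MeasurableSet {z | p z}) (hx : ∀ k, p (x k)) : ∀ᵐ z ∂empirical x, p z := by
  rw [ae_iff]
  simp only [empirical, Measure.smul_apply, Measure.finsetSum_apply, smul_eq_mul]
  rw [Finset.sum_eq_zero, mul_zero]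
  intro k _
  refine (Measure.dirac_apply' _ hp.compl).trans ?_
  simp [hx k]

theorem mainTheorem5 {d s : ℕ} (hd : 1 ≤ d)
    -- the Hilbert curve `H = σ.curve`, with `H(0) = 0`, and its pseudo-inverse `h`
    (σ : HilbertOrder d) (hσ : σ.curve 0 = 0)
    (h : (Fin d → ℝ) → ℝ) (h_meas : Measurable h) (h_inv : σ.IsPseudoInverse h)
    -- a probability measure on `[0,1)^d` with a bounded density
    (π : Measure (Fin d → ℝ)) [IsProbabilityMeasure π]
    (f : (Fin d → ℝ) → ℝ≥0) (hf : Measurable f) (M : ℝ≥0) (hfM : ∀ x ∈ unitCube d, f x ≤ M)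
    (hπ : π = (volume.restrict (unitCube d)).withDensity (fun x => (f x : ℝ≥0∞)))
    -- a Markov kernel from `[0,1)^d` to `[0,1)^s`
    (K : Kernel (Fin d → ℝ) (Fin s → ℝ)) [IsMarkovKernel K]
    (hK : ∀ x ∈ unitCube d, K x (unitCube s) = 1)
    -- for each `N`, a point set `(h₁^n, x₂^n)`, `n = 1, …, N`, in `[0,1)^(1+s)`
    (h₁ : ∀ N : ℕ, Fin N → (Fin 1 → ℝ)) (hh₁ : ∀ N n, h₁ N n ∈ unitCube 1)
    (x₂ : ∀ N : ℕ, Fin N → (Fin s → ℝ)) (hx₂ : ∀ N n, x₂ N n ∈ unitCube s)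
    (hconv : Tendsto
      (fun N => extremeNorm (empirical fun n => Fin.append (h₁ N n) (x₂ N n))
        (tensorKernel (imageLine π h) (σ.pullKernel K)))
      atTop (𝓝 0)) :
    Tendsto
      (fun N => extremeNorm (empirical fun n => Fin.append (σ.curve (h₁ N n 0)) (x₂ N n))
        (tensorKernel π K))
      atTop (𝓝 0) := by
  have hcont : π ≪ volume := by
    rw [hπ]
    exact (withDensity_absolutelyContinuous _ _).trans Measure.absolutelyContinuous_restrict
  have hcube : ∀ᵐ x ∂π, x ∈ unitCube d := by
    rw [hπ]
    exact (withDensity_absolutelyContinuous _ _).ae_le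
      (ae_restrict_mem (measurableSet_unitCube d))
  have hinv : ∀ᵐ x ∂π, σ.curve (h x) = x :=
    hcube.mono fun x hx => (h_inv x fun i => ⟨(hx i).1, (hx i).2.le⟩).2
  -- `h x = 1` only at the endpoint of the curve
  have : Nonempty (Fin d) := ⟨⟨0, hd⟩⟩
  have hlt : ∀ᵐ x ∂π, h x ∈ Set.Ico (0 : ℝ) 1 := by
    -- Points are Lebesgue-null since `d ≥ 1`, hence `π`-null.
    have hne : ∀ᵐ x ∂π, x ≠ σ.curve 1 := by
      rw [ae_iff]
      simpa using hcont (measure_singleton (σ.curve 1))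
    filter_upwards [hcube, hne] with x hx hx1
    obtain ⟨⟨h0, h1⟩, h2⟩ := h_inv x fun i => ⟨(hx i).1, (hx i).2.le⟩
    refine ⟨h0, lt_of_le_of_ne h1 fun h3 => hx1 ?_⟩
    rw [← h2, h3]
  have h_line : Measurable fun (x : Fin d → ℝ) (_ : Fin 1) => h x :=
    measurable_pi_lambda _ fun _ => h_meas
  have : IsProbabilityMeasure (imageLine π h) :=
    Measure.isProbabilityMeasure_map h_line.aemeasurable
  have hI : MeasurableSet {z : Fin (1 + s) → ℝ | z (Fin.castAdd s 0) ∈ Set.Ico (0 : ℝ) 1} :=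
    (measurable_pi_apply _) measurableSet_Ico
  set ν := tensorKernel (imageLine π h) (σ.pullKernel K) with hνdef
  have hmap : ν.map (σ.lift s) = tensorKernel π K := σ.map_lift_tensorKernel h_meas π hinv K
  have hν : ∀ᵐ z ∂ν, z (Fin.castAdd s 0) ∈ Set.Ico (0 : ℝ) 1 := by
    have hA : MeasurableSet {t : Fin 1 → ℝ | t 0 ∈ (Set.Ico (0 : ℝ) 1)ᶜ} :=
      (measurable_pi_apply 0) measurableSet_Ico.compl
    rw [ae_iff]
    refine (tensorKernel_fst_preimage (imageLine π h) (σ.pullKernel K) hA).trans ?_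
    rw [imageLine, Measure.map_apply h_line hA]
    exact hlt
  -- By `hmap` and the first marginal, this mass is `π (nearFaces ..)`. The `4` is two faces times
  -- the width `2 * 2^(-m)`.
  have hnear : ∀ (m : ℕ) (a b : Fin d → ℝ),
      ν.real {z | σ.curve (z (Fin.castAdd s 0)) ∈ nearFaces (1 / 2 ^ m) a b} ≤
        M * d * 4 * (1 / 2) ^ m := fun m a b => by
    have hA := measurableSet_nearFaces (1 / 2 ^ m) a b
    have hA' : MeasurableSet {z : Fin (d + s) → ℝ |
        (fun i => z (Fin.castAdd s i)) ∈ nearFaces (1 / 2 ^ m) a b} :=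
      (measurable_pi_lambda _ fun _ => measurable_pi_apply _) hA
    have key := tensorKernel_fst_preimage π K hA
    rw [← hmap, Measure.map_apply (σ.measurable_lift s) hA'] at key
    have hset : {z : Fin (1 + s) → ℝ | σ.curve (z (Fin.castAdd s 0)) ∈ nearFaces (1 / 2 ^ m) a b} =
        σ.lift s ⁻¹' {z | (fun i => z (Fin.castAdd s i)) ∈ nearFaces (1 / 2 ^ m) a b} := by
      ext z
      simp [HilbertOrder.lift]
    rw [measureReal_def, hset, key]
    refine (ENNReal.toReal_mono (by finiteness) (measure_nearFaces_le hfM hπ _ a b)).trans_eq ?_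
    have h0 : (0 : ℝ) ≤ 2 * (1 / 2 ^ m) := by positivity
    simp only [ENNReal.toReal_mul, ENNReal.coe_toReal, ENNReal.toReal_natCast,
      ENNReal.toReal_ofNat, ENNReal.toReal_ofReal h0]
    rw [one_div_pow]
    ring
  have hbound : ∀ m N, extremeNorm (empirical fun n => Fin.append (σ.curve (h₁ N n 0)) (x₂ N n))
      (tensorKernel π K) ≤ 2 ^ (m * d) * extremeNorm
        (empirical fun n => Fin.append (h₁ N n) (x₂ N n)) ν + M * d * 4 * (1 / 2) ^ m :=
    fun m N => by
    rw [← hmap, ← σ.map_lift_empirical]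
    refine σ.extremeNorm_map_lift_le _ ν (ae_empirical_of_forall hI fun n => ?_) hν m
      (by positivity) (hnear m)
    rw [Fin.append_left]
    exact hh₁ N n 0
  have hpow : Tendsto (fun m : ℕ => (M : ℝ) * d * 4 * (1 / 2) ^ m) atTop (𝓝 0) := by
    simpa using (tendsto_pow_atTop_nhds_zero_of_lt_one (by norm_num : (0 : ℝ) ≤ 1 / 2)
      (by norm_num)).const_mul ((M : ℝ) * d * 4)
  refine Metric.tendsto_atTop.2 fun ε hε => ?_
  -- The level is fixed before `N`, so `2^(m*d)` is a constant in the limit.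
  obtain ⟨m, hm⟩ := (hpow.eventually (gt_mem_nhds (half_pos hε))).exists
  have hN : Tendsto (fun N => (2 : ℝ) ^ (m * d) * extremeNorm
      (empirical fun n => Fin.append (h₁ N n) (x₂ N n)) ν) atTop (𝓝 0) := by
    simpa using hconv.const_mul ((2 : ℝ) ^ (m * d))
  obtain ⟨N₀, hN₀⟩ := eventually_atTop.1 (hN.eventually (gt_mem_nhds (half_pos hε)))
  refine ⟨N₀, fun N hle => ?_⟩
  rw [Real.dist_0_eq_abs, abs_of_nonneg (extremeNorm_nonneg _ _)]
  linarith [hbound m N, hN₀ N hle]
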